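/- Let $\hat{\mathbb C}=\mathbb C\cup\{\infty\}$ be the Riemann sphere, with the conventions $z\cdot\infty=\infty\cdot z=\infty$ for $z\in\hat{\mathbb C}\setminus\{0\}$ and $0\cdot\infty=\infty\cdot 0=1$. Let $$\Omega=\{(z,w)\in\hat{\mathbb C}^2 : z\cdot w\neq 1\},$$ an open subset of $\hat{\mathbb C}^2$ and hence a complex manifold of dimension $2$. Let $\mathcal H(\Omega)$ be the space of all holomorphic functions $f:\Omega\to\mathbb C$ with the topology of locally uniform convergence. For integers $p,q\ge 0$ let $f_{p,q}:\Omega\to\mathbb C$ be the function $$f_{p,q}(z,w)=\frac{z^pw^q}{(1-zw)^{\max\{p,q\}}},$$ extended continuously to the points $(z,w)\in\Omega$ with $z=\infty$ or $w=\infty$. Then every $f_{p,q}$ belongs to $\mathcal H(\Omega)$, and $(f_{p,q})_{p,q\ge 0}$ is a Schauder basis of $\mathcal H(\Omega)$: for every enumeration of the index set, each $f\in\mathcal H(\Omega)$ has exactly one expansion with respect to the $f_{p,q}$ converging in $\mathcal H(\Omega)$, and its coefficients are continuous linear functionals of $f$. In particular, each $f\in\mathcal H(\Omega)$ has a unique representation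 $$f(z,w)=\sum_{p,q=0}^{\infty}a_{p,q}\,f_{p,q}(z,w)\qquad((z,w)\in\Omega)$$ as a pointwise unconditionally convergent series with $a_{p,q}\in\mathbb C$. This series converges absolutely and locally uniformly in $\Omega$; more precisely, $\sum_{p,q}\sup_K|a_{p,q}f_{p,q}|<\infty$ for every compact $K\subseteq\Omega$. Its coefficients are $$a_{p,q}=\begin{cases}\displaystyle-\frac1{4\pi^2}\int_{|w|=1}\int_{|z|=1}f\Big(z,\frac{w}{1+zw}\Big)\frac{dz\,dw}{z^{p+1}w^{q+1}}, & p<q,\\[3mm]\displaystyle-\frac1{4\pi^2}\int_{|w|=1}\int_{|z|=1}f\Big(\frac{z}{1+zw},w\Big)\frac{dz\,dw}{z^{p+1}w^{q+1}}, & p\ge q,\end{cases}$$ where the circles are positively oriented, quotients with denominator $1+zw=0$ are read as $\infty$, and the integrands are continuous on the torus $|z|=|w|=1$. -/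

import Mathlib

open scoped OnePoint Topology

noncomputable section

namespace ComplexifiedCircle

/-- The Riemann sphere `ℂ ∪ {∞}` with its usual topology. -/
abbrev Sphere : Type := OnePoint ℂ

/-- The product on the Riemann sphere, with the convention `z * ∞ = ∞ * z = ∞` for `z ≠ 0`
(in particular `∞ * ∞ = ∞`) and `0 * ∞ = ∞ * 0 = 1`. -/
def sphereMul : Sphere → Sphere → Sphere
  | OnePoint.some z, OnePoint.some w => ((z * w : ℂ) : Sphere)
  | OnePoint.some z, ∞ => if z = 0 then ((1 : ℂ) : Sphere) else ∞
  | ∞, OnePoint.some w => if w = 0 then ((1 : ℂ) : Sphere) else ∞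
  | ∞, ∞ => ∞

/-- The quotient `a / b` of two complex numbers as a point of the Riemann sphere; it is `∞` if
`b = 0`. It is only used where `a` and `b` do not vanish simultaneously. -/
def sphereDiv (a b : ℂ) : Sphere := if b = 0 then ∞ else ((a / b : ℂ) : Sphere)

/-- The reciprocal of a point of the Riemann sphere other than `0`, as a complex number:
`1 / ∞ = 0`. -/
def recip : Sphere → ℂ
  | OnePoint.some z => z⁻¹
  | ∞ => 0

/-- The complement of the complexified unit circle, `{(z, w) ∈ Ĉ × Ĉ : z * w ≠ 1}`. It carries
the subspace topology of `Ĉ × Ĉ`. -/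
def Omega : Set (Sphere × Sphere) := {x | sphereMul x.1 x.2 ≠ ((1 : ℂ) : Sphere)}

/-- The common range `{(u, v) ∈ ℂ × ℂ : u * v ≠ 1}` of the two charts of `Omega`. -/
def chartRange : Set (ℂ × ℂ) := {x | x.1 * x.2 ≠ 1}

/-- The inverse `(u, v) ↦ (u, v)` of the standard chart of `Omega`, whose domain is
`Omega ∩ (ℂ × ℂ)`. -/
def stdChartInv (x : ℂ × ℂ) (hx : x ∈ chartRange) : Omega :=
  ⟨((x.1 : Sphere), (x.2 : Sphere)), fun h => hx (OnePoint.coe_injective h)⟩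

/-- The inverse `(u, v) ↦ (1 / v, 1 / u)` of the flip chart `(z, w) ↦ (1 / w, 1 / z)` of `Omega`,
whose domain is `Omega ∩ ((Ĉ \ {0}) × (Ĉ \ {0}))`; here `1 / 0 = ∞`. -/
def flipChartInv (x : ℂ × ℂ) (hx : x ∈ chartRange) : Omega :=
  ⟨(sphereDiv 1 x.2, sphereDiv 1 x.1), by
    obtain ⟨u, v⟩ := x
    change sphereMul (sphereDiv 1 v) (sphereDiv 1 u) ≠ _
    by_cases hu : u = 0 <;> by_cases hv : v = 0
    · simp [sphereDiv, hu, hv, sphereMul]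
    · simp [sphereDiv, hu, hv, sphereMul]
    · simp [sphereDiv, hu, hv, sphereMul]
    · simp only [sphereDiv, hu, hv, if_false, sphereMul, ne_eq, OnePoint.coe_eq_coe]
      intro h
      field_simp at h
      exact hx (by simpa [mul_comm] using h.symm)⟩

open Classical in
/-- A function on the complex surface `Omega` is holomorphic if its expressions in the two charts
are holomorphic functions of two complex variables on the range of the chart. (The value `0`
off `chartRange` is irrelevant.) -/
def IsHolomorphic (f : Omega → ℂ) : Prop :=
  DifferentiableOn ℂ (fun x => if hx : x ∈ chartRange then f (stdChartInv x hx) else 0)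
    chartRange ∧
  DifferentiableOn ℂ (fun x => if hx : x ∈ chartRange then f (flipChartInv x hx) else 0)
    chartRange

/-- The space of all holomorphic functions on `Omega` (these are automatically continuous). Its
topology is the subspace topology of the compact-open topology on `C(Omega, ℂ)`, that is, the
topology of locally uniform convergence. -/
def HolOmega : Submodule ℂ C(Omega, ℂ) where
  carrier := {f | IsHolomorphic f}
  zero_mem' := by
    constructor <;>
    exact (differentiableOn_const (0 : ℂ)).congr fun x hx => by simp
  add_mem' {f g} hf hg := by
    constructor
    · exact (hf.1.add hg.1).congr fun x hx => by simp [hx]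
    · exact (hf.2.add hg.2).congr fun x hx => by simp [hx]
  smul_mem' c f hf := by
    constructor
    · exact (hf.1.const_smul c).congr fun x hx => by simp [hx]
    · exact (hf.2.const_smul c).congr fun x hx => by simp [hx]

/-- The function `f_{p,q}(z, w) = z ^ p * w ^ q / (1 - z * w) ^ max p q` on `Omega`. If `z` or `w`
is `∞` its value is that of the continuous extension, obtained by writing the quotient in terms of
`1 / z` and `1 / w`. -/
def basisFun (p q : ℕ) (x : Omega) : ℂ :=
  match x.1 with
  | (OnePoint.some z, OnePoint.some w) => z ^ p * w ^ q / (1 - z * w) ^ max p q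
  | (z, w) => recip z ^ (max p q - p) * recip w ^ (max p q - q) /
      (recip z * recip w - 1) ^ max p q

/-- The map `(z, w) ↦ (z / (1 + z * w), w)` from `ℂ × ℂ` to `Omega`, the inverse of
`Ψ₊(z, w) = (z / (1 - z * w), w)`. -/
def psiPlusInv (z w : ℂ) : Omega :=
  ⟨(sphereDiv z (1 + z * w), (w : Sphere)), by
    change sphereMul (sphereDiv z (1 + z * w)) w ≠ _
    by_cases h : 1 + z * w = 0
    · have hw : w ≠ 0 := by rintro rfl; simp at h
      simp [sphereDiv, h, sphereMul, hw]
    · simp only [sphereDiv, h, if_false, sphereMul, ne_eq, OnePoint.coe_eq_coe]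
      intro h'
      field_simp at h'
      simp at h'⟩

/-- The map `(z, w) ↦ (z, w / (1 + z * w))` from `ℂ × ℂ` to `Omega`, the inverse of
`Ψ₋(z, w) = (z, w / (1 - z * w))`. -/
def psiMinusInv (z w : ℂ) : Omega :=
  ⟨((z : Sphere), sphereDiv w (1 + z * w)), by
    change sphereMul z (sphereDiv w (1 + z * w)) ≠ _
    by_cases h : 1 + z * w = 0
    · have hz : z ≠ 0 := by rintro rfl; simp at h
      simp [sphereDiv, h, sphereMul, hz]
    · simp only [sphereDiv, h, if_false, sphereMul, ne_eq, OnePoint.coe_eq_coe]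
      intro h'
      field_simp at h'
      simp at h'⟩

/-- The integrand of the double Cauchy integral for the coefficient with index `(p, q)`. -/
def coeffIntegrand (f : Omega → ℂ) (p q : ℕ) (z w : ℂ) : ℂ :=
  (if p < q then f (psiMinusInv z w) else f (psiPlusInv z w)) / (z ^ (p + 1) * w ^ (q + 1))

/-- The coefficient
`-1 / (4 π²) ∫_{|w| = 1} ∫_{|z| = 1} f(z, w / (1 + z w)) / (z ^ (p + 1) w ^ (q + 1)) dz dw`
for `p < q`, and with `f(z / (1 + z w), w)` in place of `f(z, w / (1 + z w))` for `q ≤ p`. -/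
def schauderCoeff (f : Omega → ℂ) (p q : ℕ) : ℂ :=
  -1 / (4 * (Real.pi : ℂ) ^ 2) * ∮ w in C(0, 1), ∮ z in C(0, 1), coeffIntegrand f p q z w

/-- A sequence `e` in a topological vector space `X` is a Schauder basis if every `x` has a unique
expansion `x = ∑ aₙ eₙ`, the partial sums converging in the topology of `X`, and if the
coefficients of this expansion are continuous linear functionals of `x`. -/
def IsSchauderBasis {X : Type*} [AddCommGroup X] [Module ℂ X] [TopologicalSpace X]
    (e : ℕ → X) : Prop :=
  (∀ x : X, ∃! a : ℕ → ℂ,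
    Filter.Tendsto (fun N => ∑ n ∈ Finset.range N, a n • e n) Filter.atTop (𝓝 x)) ∧
  ∃ coord : ℕ → X →L[ℂ] ℂ, ∀ x : X,
    Filter.Tendsto (fun N => ∑ n ∈ Finset.range N, coord n x • e n) Filter.atTop (𝓝 x)

end ComplexifiedCircle

end

open ComplexifiedCircle

/-! Pulling `f` back by `psiPlusInv` and `psiMinusInv` gives two entire functions on ℂ². The
coefficient at (p, q) is a Taylor coefficient of the first if p ≥ q and of the second if p < q.
These functionals are biorthogonal to the f_{p,q} (`coeffCLM_basisMap`): each pullback of f_{p,q} is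
z^p w^q times a power of 1 + zw, which is trivial on the matching side and in any case preserves the
difference of the exponents.

On a compact set |f_{p,q}| ≤ R^(p+q) for some R, while Cauchy's estimates make the coefficients
decay faster than any geometric rate; hence absolute and uniform convergence. Conversely, pointwise
convergence of any expansion forces this decay (`rapidlyDecaying_of_hasSum`), so the functionals may
be applied termwise and the coefficients are unique.

For existence, half of each Taylor series must recombine to `f`. Along t ↦ (tz, w/t), where 1 + zw
is constant, both series become Laurent series in t of one function on ℂ∖{0}. By Liouville their
principal parts agree (`hasSum_principal_part_eq_zero`), so the terms p < q of one series may
replace those of the other (`hasSum_coeffCLM_psiMinusInv`). This settles the points with finite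
coordinates, which are dense, and continuity gives the rest (`hasSum_coeffCLM`). -/

open Filter in
theorem ContinuousMap.hasSum_of_forall_isCompact {ι X : Type*} [TopologicalSpace X]
    {h : ι → C(X, ℂ)} {g : C(X, ℂ)} (hg : ∀ x, HasSum (fun i => h i x) (g x))
    (hb : ∀ K : Set X, IsCompact K → ∃ u : ι → ℝ, Summable u ∧ ∀ i, ∀ x ∈ K, ‖h i x‖ ≤ u i) :
    HasSum h g := by
  rw [HasSum, SummationFilter.unconditional_filter,
    ContinuousMap.tendsto_iff_forall_isCompact_tendstoUniformlyOn]
  intro K hK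
  obtain ⟨u, hu, hle⟩ := hb K hK
  have := tendstoUniformlyOn_tsum hu hle
  refine (this.congr_right fun x _ => (hg x).tsum_eq).congr (Eventually.of_forall fun s x _ => ?_)
  simp

namespace ComplexifiedCircle

/-! ### Cauchy coefficients in one variable. -/

theorem norm_cauchyIntegral_le (n : ℕ) {f : ℂ → ℂ} {M : ℝ}
    (hf : ∀ z ∈ Metric.sphere (0 : ℂ) 1, ‖f z‖ ≤ M) :
    ‖(2 * Real.pi * Complex.I : ℂ)⁻¹ • ∮ z in C(0, 1), f z / z ^ (n + 1)‖ ≤ M := by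
  have := circleIntegral.norm_two_pi_i_inv_smul_integral_le_of_norm_le_const (c := 0) (R := 1)
    (f := fun z => f z / z ^ (n + 1)) (C := M) zero_le_one (fun z hz => by
      have hz' : ‖z‖ = 1 := by simpa using hz
      simpa [hz'] using hf z hz)
  simpa using this

theorem circleIntegrable_div_pow (n : ℕ) {f : ℂ → ℂ} (hf : Continuous f) :
    CircleIntegrable (fun z => f z / z ^ (n + 1)) 0 1 := by
  apply ContinuousOn.circleIntegrable zero_le_one
  refine hf.continuousOn.div (by fun_prop) fun z hz => pow_ne_zero _ ?_
  rintro rfl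
  simp at hz

/-- The `n`-th Cauchy coefficient as a linear functional. -/
noncomputable def cauchyLinear (n : ℕ) : C(ℂ, ℂ) →ₗ[ℂ] ℂ where
  toFun f := (2 * Real.pi * Complex.I : ℂ)⁻¹ • ∮ z in C(0, 1), f z / z ^ (n + 1)
  map_add' f g := by
    rw [← smul_add, ← circleIntegral.integral_add (circleIntegrable_div_pow n f.continuous)
      (circleIntegrable_div_pow n g.continuous)]
    simp [add_div]
  map_smul' c f := by
    rw [RingHom.id_apply, smul_comm c]
    simp only [ContinuousMap.smul_apply, smul_eq_mul, mul_div_assoc,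
      circleIntegral.integral_const_mul]

/-- The `n`-th Cauchy coefficient `(2πi)⁻¹ ∮ f(z) / z ^ (n + 1) dz` over the unit circle. -/
noncomputable def cauchyCoeff (n : ℕ) : C(ℂ, ℂ) →L[ℂ] ℂ where
  toLinearMap := cauchyLinear n
  cont := by
    refine continuous_of_continuousAt_zero (cauchyLinear n) ?_
    rw [ContinuousAt, map_zero, Metric.tendsto_nhds]
    intro ε hε
    -- The functional is bounded by the supremum over the unit circle, so a basic compact-open
    -- neighbourhood of 0 suffices; ε / 2 makes the final inequality strict.
    have hopen := ContinuousMap.isOpen_setOfPred_mapsTo (X := ℂ) (Y := ℂ)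
      (isCompact_sphere (0 : ℂ) 1) (Metric.isOpen_ball (x := (0 : ℂ)) (ε := ε / 2))
    filter_upwards [hopen.mem_nhds (x := 0) (fun z _ => by simpa using hε)] with f hf
    rw [dist_zero_right]
    refine (norm_cauchyIntegral_le n (M := ε / 2) fun z hz => ?_).trans_lt (by linarith)
    exact (mem_ball_zero_iff.1 (hf hz)).le

theorem cauchyCoeff_apply (n : ℕ) (f : C(ℂ, ℂ)) : cauchyCoeff n f =
    (2 * Real.pi * Complex.I : ℂ)⁻¹ • ∮ z in C(0, 1), f z / z ^ (n + 1) := rfl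

theorem norm_cauchyCoeff_le (n : ℕ) {f : C(ℂ, ℂ)} {M : ℝ}
    (hf : ∀ z ∈ Metric.sphere (0 : ℂ) 1, ‖f z‖ ≤ M) : ‖cauchyCoeff n f‖ ≤ M :=
  norm_cauchyIntegral_le n hf

theorem cauchyCoeff_mul_pow (n m : ℕ) (c : ℂ) {f : C(ℂ, ℂ)} (hf : ∀ z, f z = c * z ^ m) :
    cauchyCoeff n f = if m = n then c else 0 := by
  have h1 : ∮ z in C(0, 1), f z / z ^ (n + 1) =
      ∮ z in C(0, 1), c * (z - 0) ^ ((m : ℤ) - n - 1) := by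
    refine circleIntegral.integral_congr zero_le_one fun z hz => ?_
    have hz : z ≠ 0 := by rintro rfl; simp at hz
    simp only [hf, sub_zero]
    rw [mul_div_assoc, sub_sub, zpow_sub₀ hz]
    norm_cast
  rw [cauchyCoeff_apply, h1, circleIntegral.integral_const_mul]
  split_ifs with h
  · subst h
    have := circleIntegral.integral_sub_center_inv 0 (one_ne_zero (α := ℝ))
    simp only [sub_self, zero_sub, zpow_neg_one, this, smul_eq_mul]
    field_simp [Complex.two_pi_I_ne_zero]
  · rw [circleIntegral.integral_sub_zpow_of_ne (by omega)]
    simp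

theorem hasSum_cauchyCoeff {f : C(ℂ, ℂ)} (hf : Differentiable ℂ f) (z : ℂ) :
    HasSum (fun n => cauchyCoeff n f * z ^ n) (f z) := by
  have h := (hf.hasFPowerSeriesOnBall 0 (R := 1) zero_lt_one).hasSum (y := z) (by simp)
  rw [zero_add] at h
  convert! h using 2 with n
  rw [cauchyPowerSeries_apply, cauchyCoeff_apply, smul_eq_mul, smul_eq_mul, mul_assoc,
    mul_comm _ (z ^ n), ← circleIntegral.integral_const_mul]
  congr 2
  ext ζ
  simp only [sub_zero, smul_eq_mul, div_eq_mul_inv, mul_pow, pow_succ, mul_inv, inv_pow]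
  ring

/-! ### Taylor expansion of entire functions of two variables. -/

/-- `g(z, w)` as a continuous family, indexed by `w`, of continuous functions of `z`. -/
noncomputable def currySnd : C(ℂ × ℂ, ℂ) →L[ℂ] C(ℂ, C(ℂ, ℂ)) where
  toFun g := (g.comp ContinuousMap.prodSwap).curry
  map_add' _ _ := rfl
  map_smul' _ _ := rfl
  cont := ContinuousMap.continuous_curry.comp (ContinuousMap.continuous_precomp _)

/-- The double Cauchy coefficient over the torus `|z| = |w| = 1`. -/
noncomputable def torusCoeff (p q : ℕ) : C(ℂ × ℂ, ℂ) →L[ℂ] ℂ :=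
  cauchyCoeff q ∘L (cauchyCoeff p).compLeftContinuous ℂ ℂ ∘L currySnd

theorem torusCoeff_apply (p q : ℕ) (g : C(ℂ × ℂ, ℂ)) : torusCoeff p q g =
    cauchyCoeff q ((cauchyCoeff p).compLeftContinuous ℂ ℂ (currySnd g)) := rfl

theorem norm_torusCoeff_le (p q : ℕ) {g : C(ℂ × ℂ, ℂ)} {M : ℝ}
    (hg : ∀ x : ℂ × ℂ, ‖x.1‖ = 1 → ‖x.2‖ = 1 → ‖g x‖ ≤ M) : ‖torusCoeff p q g‖ ≤ M :=
  norm_cauchyCoeff_le q fun w hw => norm_cauchyCoeff_le p fun z hz =>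
    hg (z, w) (by simpa using hz) (by simpa using hw)

theorem torusCoeff_monomial (p q i j : ℕ) (c : ℂ) {g : C(ℂ × ℂ, ℂ)}
    (hg : ∀ z w, g (z, w) = c * (z ^ i * w ^ j)) :
    torusCoeff p q g = if i = p ∧ j = q then c else 0 := by
  rw [torusCoeff_apply, cauchyCoeff_mul_pow q j (if i = p then c else 0)]
  · split_ifs <;> simp_all
  · intro w
    change cauchyCoeff p (currySnd g w) = _
    rw [cauchyCoeff_mul_pow p i (c * w ^ j)]
    · split_ifs <;> simp
    · intro z
      change g (z, w) = _
      rw [hg]; ring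

theorem torusCoeff_congr (p q : ℕ) {g h : C(ℂ × ℂ, ℂ)}
    (hgh : ∀ x : ℂ × ℂ, ‖x.1‖ = 1 → ‖x.2‖ = 1 → g x = h x) :
    torusCoeff p q g = torusCoeff p q h := by
  rw [← sub_eq_zero, ← map_sub, ← norm_le_zero_iff]
  exact norm_torusCoeff_le p q fun x h1 h2 => by simp [hgh x h1 h2]

/-- The radial retraction of the bidisc `|z|, |w| ≤ 1`. -/
noncomputable def bidiscRetraction : C(ℂ × ℂ, ℂ × ℂ) where
  toFun x := (x.1 / (max 1 ‖x.1‖ : ℝ), x.2 / (max 1 ‖x.2‖ : ℝ))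
  continuous_toFun := by
    have h : ∀ z : ℂ, ((max 1 ‖z‖ : ℝ) : ℂ) ≠ 0 := fun z =>
      Complex.ofReal_ne_zero.2 (by positivity)
    exact (Continuous.div (by fun_prop) (by fun_prop) fun x => h _).prodMk
      (Continuous.div (by fun_prop) (by fun_prop) fun x => h _)

theorem norm_div_max_le (z : ℂ) : ‖z / (max 1 ‖z‖ : ℝ)‖ ≤ 1 := by
  rw [norm_div, Complex.norm_real, Real.norm_of_nonneg (by positivity)]
  exact div_le_one_of_le₀ (le_max_right _ _) (by positivity)

theorem torusCoeff_comp_retraction (p q : ℕ) (g : C(ℂ × ℂ, ℂ)) :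
    torusCoeff p q (g.comp bidiscRetraction) = torusCoeff p q g :=
  torusCoeff_congr p q fun x h1 h2 => by simp [bidiscRetraction, h1, h2]

/-- Convergence is known only on the closed bidisc. Precomposing with the retraction makes it
global, and leaves the coefficients unchanged because the torus is fixed. -/
theorem hasSum_torusCoeff {ι : Type*} (p q : ℕ) {h : ι → C(ℂ × ℂ, ℂ)} {g : C(ℂ × ℂ, ℂ)}
    (hg : ∀ x : ℂ × ℂ, ‖x.1‖ ≤ 1 → ‖x.2‖ ≤ 1 → HasSum (fun i => h i x) (g x))
    {u : ι → ℝ} (hu : Summable u)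
    (hb : ∀ i, ∀ x : ℂ × ℂ, ‖x.1‖ ≤ 1 → ‖x.2‖ ≤ 1 → ‖h i x‖ ≤ u i) :
    HasSum (fun i => torusCoeff p q (h i)) (torusCoeff p q g) := by
  have : HasSum (fun i => (h i).comp bidiscRetraction) (g.comp bidiscRetraction) :=
    ContinuousMap.hasSum_of_forall_isCompact
      (fun x => hg _ (norm_div_max_le _) (norm_div_max_le _))
      fun K _ => ⟨u, hu, fun i x _ => hb i _ (norm_div_max_le _) (norm_div_max_le _)⟩
  simpa only [torusCoeff_comp_retraction] using (torusCoeff p q).hasSum this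

theorem summable_const_mul_pow_mul_pow (M : ℝ) {r s : ℝ} (hr : 0 ≤ r) (hr' : r < 1) (hs : 0 ≤ s)
    (hs' : s < 1) : Summable fun n : ℕ × ℕ => M * (r ^ n.1 * s ^ n.2) :=
  ((summable_geometric_of_lt_one hr hr').mul_of_nonneg (summable_geometric_of_lt_one hs hs')
    (fun _ => pow_nonneg hr _) fun _ => pow_nonneg hs _).mul_left M

theorem exists_norm_torusCoeff_le (g : C(ℂ × ℂ, ℂ)) :
    ∃ M : ℝ, ∀ p q, ‖torusCoeff p q g‖ ≤ M := by
  obtain ⟨M, hM⟩ := ((isCompact_sphere (0 : ℂ) 1).prod (isCompact_sphere (0 : ℂ) 1)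
    ).exists_bound_of_continuousOn g.continuous.continuousOn
  exact ⟨M, fun p q => norm_torusCoeff_le p q fun x h1 h2 => hM x (by simp [h1, h2])⟩

theorem hasSum_torusCoeff_of_norm_lt_one {g : C(ℂ × ℂ, ℂ)} (hg : Differentiable ℂ g) {z w : ℂ}
    (hz : ‖z‖ < 1) (hw : ‖w‖ < 1) :
    HasSum (fun n : ℕ × ℕ => torusCoeff n.1 n.2 g * (z ^ n.1 * w ^ n.2)) (g (z, w)) := by
  let e : ℕ → C(ℂ, ℂ) := fun p => (cauchyCoeff p).compLeftContinuous ℂ ℂ (currySnd g)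
  let h : C(ℂ, ℂ) := g.comp ((ContinuousMap.const ℂ z).prodMk (ContinuousMap.id ℂ))
  have hh : HasSum (fun q => cauchyCoeff q h * w ^ q) (g (z, w)) :=
    hasSum_cauchyCoeff (f := h) (hg.comp (by fun_prop : Differentiable ℂ fun ω => (z, ω))) w
  -- The expansion in the first variable converges in `C(ℂ, ℂ)`, as functions of the second
  -- variable, so `cauchyCoeff q` can be applied to it termwise.
  have he : HasSum (fun p => z ^ p • e p) h := by
    refine ContinuousMap.hasSum_of_forall_isCompact (fun ω => ?_) fun K hK => ?_
    · have := hasSum_cauchyCoeff (f := currySnd g ω)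
        (hg.comp (by fun_prop : Differentiable ℂ fun ζ => (ζ, ω))) z
      simpa only [mul_comm] using! this
    · obtain ⟨M, hM⟩ := ((isCompact_sphere (0 : ℂ) 1).prod hK).exists_bound_of_continuousOn
        g.continuous.continuousOn
      refine ⟨fun p => ‖z‖ ^ p * M, (summable_geometric_of_lt_one (norm_nonneg z) hz).mul_right M,
        fun p ω hω => ?_⟩
      have : ‖e p ω‖ ≤ M := norm_cauchyCoeff_le p fun ζ hζ => hM (ζ, ω) ⟨hζ, hω⟩
      simpa using mul_le_mul_of_nonneg_left this (pow_nonneg (norm_nonneg z) p)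
  obtain ⟨M, hM⟩ := exists_norm_torusCoeff_le g
  have hs : Summable fun n : ℕ × ℕ => torusCoeff n.1 n.2 g * (z ^ n.1 * w ^ n.2) := by
    refine .of_norm_bounded
      (summable_const_mul_pow_mul_pow M (norm_nonneg z) hz (norm_nonneg w) hw) fun n => ?_
    simpa using mul_le_mul_of_nonneg_right (hM n.1 n.2) (by positivity)
  have hs' := ((Equiv.prodComm ℕ ℕ).hasSum_iff.2 hs.hasSum).prod_fiberwise (g := fun q =>
    cauchyCoeff q h * w ^ q) fun q => by
      have := ((cauchyCoeff q).hasSum he).mul_right (w ^ q)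
      convert! this using 2 with p
      simp only [Function.comp_apply, Equiv.prodComm_apply, Prod.fst_swap, Prod.snd_swap,
        map_smul, smul_eq_mul]
      rw [torusCoeff_apply]
      ring
  rw [hh.unique hs']
  exact hs.hasSum

/-- Scaling by r < 1 sends the closed bidisc into the open one, where the expansion of `g` is
available and converges uniformly; the coefficients are then read off termwise. -/
theorem torusCoeff_comp_smul_of_lt_one (p q : ℕ) {g h : C(ℂ × ℂ, ℂ)} (hg : Differentiable ℂ g)
    {r : ℝ} (hr : 0 ≤ r) (hr' : r < 1) (hh : ∀ z w, h (z, w) = g (r * z, r * w)) :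
    torusCoeff p q h = r ^ (p + q) * torusCoeff p q g := by
  obtain ⟨M, hM⟩ := exists_norm_torusCoeff_le g
  let k : ℕ × ℕ → C(ℂ × ℂ, ℂ) := fun n =>
    ⟨fun x => r ^ (n.1 + n.2) * torusCoeff n.1 n.2 g * (x.1 ^ n.1 * x.2 ^ n.2), by fun_prop⟩
  have hlt : ∀ z : ℂ, ‖z‖ ≤ 1 → ‖(r : ℂ) * z‖ < 1 := fun z hz => by
    rw [norm_mul, Complex.norm_real, Real.norm_of_nonneg hr]
    nlinarith
  have := hasSum_torusCoeff p q (h := k) (g := h) (fun x h1 h2 => ?_)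
    (summable_const_mul_pow_mul_pow M hr hr' hr hr') fun n x h1 h2 => ?_
  · refine this.unique ?_
    convert! hasSum_ite_eq (p, q) (r ^ (p + q) * torusCoeff p q g) using 2 with n
    rw [torusCoeff_monomial p q n.1 n.2 _ fun z w => rfl]
    by_cases h : n = (p, q)
    · simp [h]
    · rw [if_neg h, if_neg fun h' => h (Prod.ext h'.1 h'.2)]
  · rw [show x = (x.1, x.2) from rfl, hh]
    convert! hasSum_torusCoeff_of_norm_lt_one hg (hlt _ h1) (hlt _ h2) using 2 with n
    simp only [k, ContinuousMap.coe_mk]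
    ring
  · simp only [k, ContinuousMap.coe_mk, norm_mul, norm_pow, Complex.norm_real,
      Real.norm_of_nonneg hr]
    have h3 : ‖x.1‖ ^ n.1 * ‖x.2‖ ^ n.2 ≤ 1 :=
      mul_le_one₀ (pow_le_one₀ (norm_nonneg _) h1) (by positivity)
        (pow_le_one₀ (norm_nonneg _) h2)
    have h4 := mul_le_mul_of_nonneg_left (hM n.1 n.2) (pow_nonneg hr (n.1 + n.2))
    calc _ ≤ r ^ (n.1 + n.2) * ‖torusCoeff n.1 n.2 g‖ * 1 :=
          mul_le_mul_of_nonneg_left h3 (by positivity)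
      _ ≤ _ := by rw [mul_one, ← pow_add, mul_comm M]; exact h4

theorem torusCoeff_comp_smul (p q : ℕ) {g h : C(ℂ × ℂ, ℂ)} (hg : Differentiable ℂ g)
    {R : ℝ} (hR : 1 < R) (hh : ∀ z w, h (z, w) = g (R * z, R * w)) :
    torusCoeff p q h = R ^ (p + q) * torusCoeff p q g := by
  have hR0 : (R : ℂ) ≠ 0 := Complex.ofReal_ne_zero.2 (by positivity)
  have hd : Differentiable ℂ h := by
    have : (h : ℂ × ℂ → ℂ) = fun x => g (R * x.1, R * x.2) := funext fun x => hh x.1 x.2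
    rw [this]
    exact hg.comp (by fun_prop : Differentiable ℂ fun x : ℂ × ℂ => ((R : ℂ) * x.1, (R : ℂ) * x.2))
  -- The contracting case is used with the roles exchanged: `g` is `h` scaled by 1/R.
  rw [torusCoeff_comp_smul_of_lt_one p q hd (r := R⁻¹) (by positivity) (inv_lt_one_of_one_lt₀ hR)
    (h := g) fun z w => by simp [hh, hR0]]
  rw [← mul_assoc, ← mul_pow, Complex.ofReal_inv, mul_inv_cancel₀ hR0, one_pow, one_mul]

/-- Cauchy's estimates for an entire function of two variables. -/
theorem exists_norm_torusCoeff_mul_pow_le {g : C(ℂ × ℂ, ℂ)} (hg : Differentiable ℂ g) {R : ℝ}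
    (hR : 1 < R) : ∃ M : ℝ, ∀ p q, ‖torusCoeff p q g‖ * R ^ (p + q) ≤ M := by
  obtain ⟨M, hM⟩ := exists_norm_torusCoeff_le
    (g.comp ⟨fun x : ℂ × ℂ => ((R : ℂ) * x.1, (R : ℂ) * x.2), by fun_prop⟩)
  refine ⟨M, fun p q => ?_⟩
  have := hM p q
  rw [torusCoeff_comp_smul p q hg hR fun z w => rfl, norm_mul, norm_pow, Complex.norm_real,
    Real.norm_of_nonneg (by positivity)] at this
  rwa [mul_comm]

/-- The Taylor expansion of an entire function of two variables. -/
theorem hasSum_torusCoeff_of_differentiable {g : C(ℂ × ℂ, ℂ)} (hg : Differentiable ℂ g)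
    (z w : ℂ) :
    HasSum (fun n : ℕ × ℕ => torusCoeff n.1 n.2 g * (z ^ n.1 * w ^ n.2)) (g (z, w)) := by
  obtain ⟨R, hR, hzR, hwR⟩ : ∃ R : ℝ, 1 < R ∧ ‖z‖ < R ∧ ‖w‖ < R :=
    ⟨2 + ‖z‖ + ‖w‖, by linarith [norm_nonneg z, norm_nonneg w], by linarith [norm_nonneg w], by linarith [norm_nonneg z]⟩
  have hR0 : (R : ℂ) ≠ 0 := Complex.ofReal_ne_zero.2 (by positivity)
  let h : C(ℂ × ℂ, ℂ) := g.comp ⟨fun x : ℂ × ℂ => ((R : ℂ) * x.1, (R : ℂ) * x.2), by fun_prop⟩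
  have hlt : ∀ ζ : ℂ, ‖ζ‖ < R → ‖ζ / R‖ < 1 := fun ζ hζ => by
    rw [norm_div, Complex.norm_real, Real.norm_of_nonneg (by positivity)]
    exact (div_lt_one (by positivity)).2 hζ
  have := hasSum_torusCoeff_of_norm_lt_one (g := h) (hg.comp
    (by fun_prop : Differentiable ℂ fun x : ℂ × ℂ => ((R : ℂ) * x.1, (R : ℂ) * x.2)))
    (hlt z hzR) (hlt w hwR)
  have hval : h (z / R, w / R) = g (z, w) := by
    simp only [h, ContinuousMap.comp_apply, ContinuousMap.coe_mk]
    rw [mul_div_cancel₀ _ hR0, mul_div_cancel₀ _ hR0]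
  rw [hval] at this
  convert! this using 2 with n
  rw [torusCoeff_comp_smul n.1 n.2 (h := h) hg hR fun z w => rfl, div_pow, div_pow, pow_add]
  field_simp

end ComplexifiedCircle

namespace ComplexifiedCircle
open Filter

/-! ### Topology of `Omega`, its charts and holomorphic functions. -/

theorem isOpen_chartRange : IsOpen chartRange :=
  isOpen_ne_fun (by fun_prop) (by fun_prop)

/-- The finite part of a point of the sphere, with `∞ ↦ 0`. -/
noncomputable def finitePart : Sphere → ℂ
  | OnePoint.some z => z
  | ∞ => 0

theorem continuousAt_finitePart (z : ℂ) : ContinuousAt finitePart (z : Sphere) :=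
  OnePoint.continuousAt_coe.2 continuousAt_id

theorem tendsto_coe_infty_cobounded :
    Tendsto ((↑) : ℂ → Sphere) (Bornology.cobounded ℂ) (𝓝 ∞) := by
  rw [Metric.cobounded_eq_cocompact, ← coclosedCompact_eq_cocompact]
  exact OnePoint.tendsto_coe_infty

theorem continuousAt_recip {x : Sphere} (hx : x ≠ ((0 : ℂ) : Sphere)) : ContinuousAt recip x := by
  induction x using OnePoint.rec with
  | infty =>
    rw [OnePoint.continuousAt_infty', coclosedCompact_eq_cocompact,
      ← Metric.cobounded_eq_cocompact]
    exact tendsto_inv₀_cobounded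
  | coe z =>
    exact OnePoint.continuousAt_coe.2 (continuousAt_inv₀ (by simpa using hx))

theorem continuous_sphereDiv_one : Continuous (sphereDiv 1) := by
  rw [continuous_iff_continuousAt]
  intro v
  by_cases hv : v = 0
  · subst hv
    rw [continuousAt_iff_punctured_nhds]
    have h : Tendsto (fun v : ℂ => ((v⁻¹ : ℂ) : Sphere)) (𝓝[≠] 0) (𝓝 (sphereDiv 1 0)) := by
      simpa [sphereDiv, Function.comp_def] using
        tendsto_coe_infty_cobounded.comp (tendsto_inv₀_nhdsNE_zero (α := ℂ))
    refine h.congr' ?_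
    filter_upwards [self_mem_nhdsWithin] with v hv
    have hv : v ≠ 0 := hv
    simp [sphereDiv, hv]
  · have h : ContinuousAt (fun v : ℂ => ((v⁻¹ : ℂ) : Sphere)) v :=
      OnePoint.continuous_coe.continuousAt.comp (continuousAt_inv₀ hv)
    refine h.congr ?_
    filter_upwards [isOpen_ne.mem_nhds hv] with v hv
    have hv : v ≠ 0 := hv
    simp [sphereDiv, hv]

theorem continuousAt_sphereDiv {a b : ℂ} (h : a ≠ 0 ∨ b ≠ 0) :
    ContinuousAt (fun p : ℂ × ℂ => sphereDiv p.1 p.2) (a, b) := by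
  by_cases hb : b = 0
  · have ha : a ≠ 0 := h.resolve_right (not_not.2 hb)
    have h : ContinuousAt (fun p : ℂ × ℂ => sphereDiv 1 (p.2 / p.1)) (a, b) :=
      continuous_sphereDiv_one.continuousAt.comp
        (f := fun p : ℂ × ℂ => p.2 / p.1) (continuousAt_snd.div continuousAt_fst ha)
    refine h.congr ?_
    filter_upwards [continuousAt_fst.eventually_ne ha] with p hp
    by_cases hp2 : p.2 = 0 <;> simp [sphereDiv, hp, hp2]
  · have h : ContinuousAt (fun p : ℂ × ℂ => ((p.1 / p.2 : ℂ) : Sphere)) (a, b) :=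
      OnePoint.continuous_coe.continuousAt.comp
        (f := fun p : ℂ × ℂ => p.1 / p.2) (continuousAt_fst.div continuousAt_snd hb)
    refine h.congr ?_
    filter_upwards [continuousAt_snd.eventually_ne hb] with p hp
    simp [sphereDiv, hp]

theorem continuous_psiPlusInv : Continuous fun x : ℂ × ℂ => psiPlusInv x.1 x.2 := by
  refine Continuous.subtype_mk (Continuous.prodMk ?_ (OnePoint.continuous_coe.comp continuous_snd)) _
  rw [continuous_iff_continuousAt]
  rintro ⟨z, w⟩
  refine (continuousAt_sphereDiv (a := z) (b := 1 + z * w) ?_).comp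
    (x := (z, w)) (f := fun x : ℂ × ℂ => (x.1, 1 + x.1 * x.2)) (by fun_prop)
  by_contra! h
  simp [h.1] at h

theorem continuous_psiMinusInv : Continuous fun x : ℂ × ℂ => psiMinusInv x.1 x.2 := by
  refine Continuous.subtype_mk (Continuous.prodMk (OnePoint.continuous_coe.comp continuous_fst) ?_) _
  rw [continuous_iff_continuousAt]
  rintro ⟨z, w⟩
  refine (continuousAt_sphereDiv (a := w) (b := 1 + z * w) ?_).comp
    (x := (z, w)) (f := fun x : ℂ × ℂ => (x.2, 1 + x.1 * x.2)) (by fun_prop)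
  by_contra! h
  simp [h.1] at h

theorem sphereDiv_one_recip {x : Sphere} (hx : x ≠ ((0 : ℂ) : Sphere)) :
    sphereDiv 1 (recip x) = x := by
  induction x using OnePoint.rec with
  | infty => simp [sphereDiv, recip]
  | coe z =>
    have : z ≠ 0 := by simpa using hx
    simp [sphereDiv, recip, this]

theorem recip_mem_chartRange {x : Sphere × Sphere} (hx : x ∈ Omega)
    (h1 : x.1 ≠ ((0 : ℂ) : Sphere)) (h2 : x.2 ≠ ((0 : ℂ) : Sphere)) :
    (recip x.2, recip x.1) ∈ chartRange := by
  obtain ⟨a, b⟩ := x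
  induction a using OnePoint.rec with
  | infty => simp [chartRange, recip]
  | coe z =>
    induction b using OnePoint.rec with
    | infty => simp [chartRange, recip]
    | coe w =>
      intro h
      apply hx
      have hz : z ≠ 0 := by simpa using h1
      have hw : w ≠ 0 := by simpa using h2
      simp only [recip] at h
      simp only [sphereMul, OnePoint.coe_eq_coe]
      field_simp at h
      rw [h, mul_comm]

/-- The convention 0 · ∞ = 1 excludes (0, ∞) and (∞, 0), so the two charts cover `Omega`. -/
theorem eq_stdChartInv_or (x : Omega) :
    (∃ z w : ℂ, x.1 = ((z : Sphere), (w : Sphere))) ∨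
      (x.1.1 ≠ ((0 : ℂ) : Sphere) ∧ x.1.2 ≠ ((0 : ℂ) : Sphere)) := by
  obtain ⟨⟨a, b⟩, hx⟩ := x
  induction a using OnePoint.rec with
  | infty =>
    refine Or.inr ⟨by simp, ?_⟩
    rintro h
    simp only at h
    subst h
    simp [Omega, sphereMul] at hx
  | coe z =>
    induction b using OnePoint.rec with
    | infty =>
      refine Or.inr ⟨?_, by simp⟩
      rintro h
      simp only at h
      rw [h] at hx
      simp [Omega, sphereMul] at hx
    | coe w => exact Or.inl ⟨z, w, rfl⟩

theorem mem_chartRange_of_mem_Omega {z w : ℂ} (h : ((z : Sphere), (w : Sphere)) ∈ Omega) :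
    (z, w) ∈ chartRange := fun h' => h (by simpa [sphereMul] using h')

open Classical in
theorem continuous_of_isHolomorphic {f : Omega → ℂ} (hf : IsHolomorphic f) : Continuous f := by
  rw [continuous_iff_continuousAt]
  intro x
  rcases eq_stdChartInv_or x with ⟨z, w, hx⟩ | ⟨h1, h2⟩
  · have hzw : (z, w) ∈ chartRange := mem_chartRange_of_mem_Omega (hx ▸ x.2)
    have hc := (hf.1.continuousOn.continuousAt (isOpen_chartRange.mem_nhds hzw))
    have hz : ContinuousAt (fun y : Omega => finitePart y.1.1) x :=
      ContinuousAt.comp (g := finitePart) (f := fun y : Omega => y.1.1)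
        (by rw [hx]; exact continuousAt_finitePart z) (by fun_prop)
    have hw : ContinuousAt (fun y : Omega => finitePart y.1.2) x :=
      ContinuousAt.comp (g := finitePart) (f := fun y : Omega => y.1.2)
        (by rw [hx]; exact continuousAt_finitePart w) (by fun_prop)
    have hcomp := ContinuousAt.comp (f := fun y : Omega => (finitePart y.1.1, finitePart y.1.2))
      (x := x) (by rw [hx]; exact hc) (hz.prodMk hw)
    refine hcomp.congr ?_
    have e1 : ∀ᶠ y : Omega in 𝓝 x, y.1.1 ≠ ∞ :=
      (by fun_prop : ContinuousAt (fun y : Omega => y.1.1) x).eventually_ne (by rw [hx]; simp)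
    have e2 : ∀ᶠ y : Omega in 𝓝 x, y.1.2 ≠ ∞ :=
      (by fun_prop : ContinuousAt (fun y : Omega => y.1.2) x).eventually_ne (by rw [hx]; simp)
    filter_upwards [e1, e2] with y h1 h2
    obtain ⟨a, ha⟩ := OnePoint.ne_infty_iff_exists.1 h1
    obtain ⟨b, hb⟩ := OnePoint.ne_infty_iff_exists.1 h2
    obtain ⟨⟨y1, y2⟩, hy⟩ := y
    simp only at ha hb
    subst ha hb
    have := mem_chartRange_of_mem_Omega hy
    simp [finitePart, this, stdChartInv]
  · have hr := recip_mem_chartRange x.2 h1 h2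
    have hc := (hf.2.continuousOn.continuousAt (isOpen_chartRange.mem_nhds hr))
    have hz : ContinuousAt (fun y : Omega => recip y.1.1) x :=
      ContinuousAt.comp (g := recip) (f := fun y : Omega => y.1.1)
        (continuousAt_recip h1) (by fun_prop)
    have hw : ContinuousAt (fun y : Omega => recip y.1.2) x :=
      ContinuousAt.comp (g := recip) (f := fun y : Omega => y.1.2)
        (continuousAt_recip h2) (by fun_prop)
    have hcomp := ContinuousAt.comp (f := fun y : Omega => (recip y.1.2, recip y.1.1))
      (x := x) hc (hw.prodMk hz)
    refine hcomp.congr ?_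
    have e1 : ∀ᶠ y : Omega in 𝓝 x, y.1.1 ≠ ((0 : ℂ) : Sphere) :=
      (by fun_prop : ContinuousAt (fun y : Omega => y.1.1) x).eventually_ne h1
    have e2 : ∀ᶠ y : Omega in 𝓝 x, y.1.2 ≠ ((0 : ℂ) : Sphere) :=
      (by fun_prop : ContinuousAt (fun y : Omega => y.1.2) x).eventually_ne h2
    filter_upwards [e1, e2] with y h1 h2
    simp [recip_mem_chartRange y.2 h1 h2, flipChartInv, sphereDiv_one_recip h1,
      sphereDiv_one_recip h2]

theorem isOpen_Omega : IsOpen Omega := by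
  rw [isOpen_iff_mem_nhds]
  intro x hx
  rcases eq_stdChartInv_or ⟨x, hx⟩ with ⟨z, w, h⟩ | ⟨h1, h2⟩
  · simp only at h
    have hzw := mem_chartRange_of_mem_Omega (h ▸ hx)
    have ho : IsOpen (Prod.map ((↑) : ℂ → Sphere) ((↑) : ℂ → Sphere) '' chartRange) :=
      (OnePoint.isOpenEmbedding_coe.prodMap OnePoint.isOpenEmbedding_coe).isOpenMap _
        isOpen_chartRange
    refine mem_of_superset (ho.mem_nhds ⟨(z, w), hzw, h.symm⟩) ?_
    rintro _ ⟨y, hy, rfl⟩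
    exact (stdChartInv y hy).2
  · have hz : ContinuousAt (fun y : Sphere × Sphere => recip y.1) x :=
      ContinuousAt.comp (g := recip) (f := Prod.fst) (continuousAt_recip h1) (by fun_prop)
    have hw : ContinuousAt (fun y : Sphere × Sphere => recip y.2) x :=
      ContinuousAt.comp (g := recip) (f := Prod.snd) (continuousAt_recip h2) (by fun_prop)
    have e := (hw.prodMk hz).eventually_mem
      (isOpen_chartRange.mem_nhds (recip_mem_chartRange hx h1 h2))
    filter_upwards [e, continuousAt_fst.eventually_ne h1, continuousAt_snd.eventually_ne h2]
      with y hy h1 h2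
    have := (flipChartInv _ hy).2
    simpa only [flipChartInv, sphereDiv_one_recip h1, sphereDiv_one_recip h2] using this

theorem dense_finite_points :
    Dense {x : Omega | ∃ z w : ℂ, x.1 = ((z : Sphere), (w : Sphere))} := by
  have h : Dense (Set.range (Prod.map ((↑) : ℂ → Sphere) ((↑) : ℂ → Sphere))) :=
    OnePoint.denseRange_coe.prodMap OnePoint.denseRange_coe
  refine (h.preimage isOpen_Omega.isOpenMap_subtype_val).mono ?_
  rintro x ⟨⟨z, w⟩, hx⟩
  exact ⟨z, w, hx.symm⟩

-- Near 1 + zw = 0 both z and w are nonzero, and in the flip chart the map reads (1/w, (1 + zw)/z),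
-- which is holomorphic there. Elsewhere the standard chart applies.
open Classical in
theorem differentiable_comp_psiPlusInv {f : Omega → ℂ} (hf : IsHolomorphic f) :
    Differentiable ℂ fun x : ℂ × ℂ => f (psiPlusInv x.1 x.2) := by
  rintro ⟨z, w⟩
  have hcs : ContinuousAt (fun x : ℂ × ℂ => 1 + x.1 * x.2) (z, w) := by fun_prop
  by_cases h : 1 + z * w = 0
  · have hz : z ≠ 0 := by rintro rfl; simp at h
    have hw : w ≠ 0 := by rintro rfl; simp at h
    have hmem : ∀ x : ℂ × ℂ, x.1 ≠ 0 → x.2 ≠ 0 → (x.2⁻¹, (1 + x.1 * x.2) / x.1) ∈ chartRange := by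
      intro x h1 h2 h3
      simp only at h3
      field_simp at h3
      simp at h3
    have hd := hf.2.differentiableAt (isOpen_chartRange.mem_nhds (hmem (z, w) hz hw))
    have hg : DifferentiableAt ℂ (fun x : ℂ × ℂ => (x.2⁻¹, (1 + x.1 * x.2) / x.1)) (z, w) :=
      by
      fun_prop (disch := assumption)
    refine (DifferentiableAt.comp (z, w) hd hg).congr_of_eventuallyEq ?_
    filter_upwards [continuousAt_fst.eventually_ne hz, continuousAt_snd.eventually_ne hw]
      with x h1 h2
    simp only [Function.comp_apply, dif_pos (hmem x h1 h2)]
    congr 1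
    apply Subtype.ext
    by_cases hx : 1 + x.1 * x.2 = 0 <;> simp [psiPlusInv, flipChartInv, sphereDiv, hx, h1, h2]
  · have hmem : ∀ x : ℂ × ℂ, 1 + x.1 * x.2 ≠ 0 → (x.1 / (1 + x.1 * x.2), x.2) ∈ chartRange := by
      intro x h1 h3
      simp only at h3
      field_simp at h3
      simp at h3
    have hd := hf.1.differentiableAt (isOpen_chartRange.mem_nhds (hmem (z, w) h))
    have hg : DifferentiableAt ℂ (fun x : ℂ × ℂ => (x.1 / (1 + x.1 * x.2), x.2)) (z, w) :=
      by
      fun_prop (disch := assumption)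
    refine (DifferentiableAt.comp (z, w) hd hg).congr_of_eventuallyEq ?_
    filter_upwards [hcs.eventually_ne h] with x h1
    simp only [Function.comp_apply, dif_pos (hmem x h1)]
    congr 1
    apply Subtype.ext
    simp [psiPlusInv, stdChartInv, sphereDiv, h1]

open Classical in
theorem differentiable_comp_psiMinusInv {f : Omega → ℂ} (hf : IsHolomorphic f) :
    Differentiable ℂ fun x : ℂ × ℂ => f (psiMinusInv x.1 x.2) := by
  rintro ⟨z, w⟩
  have hcs : ContinuousAt (fun x : ℂ × ℂ => 1 + x.1 * x.2) (z, w) := by fun_prop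
  by_cases h : 1 + z * w = 0
  · have hz : z ≠ 0 := by rintro rfl; simp at h
    have hw : w ≠ 0 := by rintro rfl; simp at h
    have hmem : ∀ x : ℂ × ℂ, x.1 ≠ 0 → x.2 ≠ 0 → ((1 + x.1 * x.2) / x.2, x.1⁻¹) ∈ chartRange := by
      intro x h1 h2 h3
      simp only at h3
      field_simp at h3
      simp at h3
    have hd := hf.2.differentiableAt (isOpen_chartRange.mem_nhds (hmem (z, w) hz hw))
    have hg : DifferentiableAt ℂ (fun x : ℂ × ℂ => ((1 + x.1 * x.2) / x.2, x.1⁻¹)) (z, w) :=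
      by
      fun_prop (disch := assumption)
    refine (DifferentiableAt.comp (z, w) hd hg).congr_of_eventuallyEq ?_
    filter_upwards [continuousAt_fst.eventually_ne hz, continuousAt_snd.eventually_ne hw]
      with x h1 h2
    simp only [Function.comp_apply, dif_pos (hmem x h1 h2)]
    congr 1
    apply Subtype.ext
    by_cases hx : 1 + x.1 * x.2 = 0 <;> simp [psiMinusInv, flipChartInv, sphereDiv, hx, h1, h2]
  · have hmem : ∀ x : ℂ × ℂ, 1 + x.1 * x.2 ≠ 0 → (x.1, x.2 / (1 + x.1 * x.2)) ∈ chartRange := by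
      intro x h1 h3
      simp only at h3
      field_simp at h3
      simp at h3
    have hd := hf.1.differentiableAt (isOpen_chartRange.mem_nhds (hmem (z, w) h))
    have hg : DifferentiableAt ℂ (fun x : ℂ × ℂ => (x.1, x.2 / (1 + x.1 * x.2))) (z, w) :=
      by
      fun_prop (disch := assumption)
    refine (DifferentiableAt.comp (z, w) hd hg).congr_of_eventuallyEq ?_
    filter_upwards [hcs.eventually_ne h] with x h1
    simp only [Function.comp_apply, dif_pos (hmem x h1)]
    congr 1
    apply Subtype.ext
    simp [psiMinusInv, stdChartInv, sphereDiv, h1]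

theorem basisFun_stdChartInv (p q : ℕ) (x : ℂ × ℂ) (hx : x ∈ chartRange) :
    basisFun p q (stdChartInv x hx) = x.1 ^ p * x.2 ^ q / (1 - x.1 * x.2) ^ max p q := rfl

theorem basisFun_flipChartInv (p q : ℕ) (x : ℂ × ℂ) (hx : x ∈ chartRange) :
    basisFun p q (flipChartInv x hx) =
      x.2 ^ (max p q - p) * x.1 ^ (max p q - q) / (x.1 * x.2 - 1) ^ max p q := by
  obtain ⟨u, v⟩ := x
  by_cases hu : u = 0 <;> by_cases hv : v = 0
  · simp [basisFun, flipChartInv, sphereDiv, hu, hv, recip]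
  · simp [basisFun, flipChartInv, sphereDiv, hu, hv, recip]
  · simp [basisFun, flipChartInv, sphereDiv, hu, hv, recip]
  · have h1 : u * v - 1 ≠ 0 := sub_ne_zero.2 hx
    have h2 : 1 - 1 / v * (1 / u) = (u * v - 1) / (u * v) := by field_simp
    simp only [basisFun, flipChartInv, sphereDiv, hu, hv, if_false]
    rw [h2, div_pow (u * v - 1), mul_pow u v, pow_sub₀ _ hv (le_max_left p q),
      pow_sub₀ _ hu (le_max_right p q)]
    simp only [div_pow, one_pow]
    field_simp

theorem isHolomorphic_basisFun (p q : ℕ) : IsHolomorphic (basisFun p q) := by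
  constructor
  · have : DifferentiableOn ℂ (fun x : ℂ × ℂ => x.1 ^ p * x.2 ^ q / (1 - x.1 * x.2) ^ max p q)
        chartRange :=
      by
      intro x hx
      have h : (1 - x.1 * x.2) ^ max p q ≠ 0 := pow_ne_zero _ (sub_ne_zero.2 (Ne.symm hx))
      exact DifferentiableAt.differentiableWithinAt (by fun_prop (disch := assumption))
    exact this.congr fun x hx => by rw [dif_pos hx, basisFun_stdChartInv]
  · have : DifferentiableOn ℂ (fun x : ℂ × ℂ =>
        x.2 ^ (max p q - p) * x.1 ^ (max p q - q) / (x.1 * x.2 - 1) ^ max p q) chartRange :=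
      by
      intro x hx
      have h : (x.1 * x.2 - 1) ^ max p q ≠ 0 := pow_ne_zero _ (sub_ne_zero.2 hx)
      exact DifferentiableAt.differentiableWithinAt (by fun_prop (disch := assumption))
    exact this.congr fun x hx => by rw [dif_pos hx, basisFun_flipChartInv]

end ComplexifiedCircle

namespace ComplexifiedCircle
open Filter

/-! ### The basis functions and their pullbacks to ℂ². -/

/-- Together with `basisFun_of_ge`, this reduces estimates, and evaluations at infinity, to the
generators f_{1,0}, f_{0,1}, f_{1,1}. -/
theorem basisFun_of_le {p q : ℕ} (h : q ≤ p) (x : Omega) :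
    basisFun p q x = basisFun 1 0 x ^ (p - q) * basisFun 1 1 x ^ q := by
  obtain ⟨k, rfl⟩ := Nat.exists_eq_add_of_le h
  obtain ⟨⟨a, b⟩, hx⟩ := x
  induction a using OnePoint.rec <;> induction b using OnePoint.rec <;>
    simp [basisFun, pow_add, mul_pow, mul_comm, div_eq_mul_inv] <;> ring

theorem basisFun_of_ge {p q : ℕ} (h : p ≤ q) (x : Omega) :
    basisFun p q x = basisFun 0 1 x ^ (q - p) * basisFun 1 1 x ^ p := by
  obtain ⟨k, rfl⟩ := Nat.exists_eq_add_of_le h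
  obtain ⟨⟨a, b⟩, hx⟩ := x
  induction a using OnePoint.rec <;> induction b using OnePoint.rec <;>
    simp [basisFun, pow_add, mul_pow, mul_comm, div_eq_mul_inv] <;> ring

theorem norm_basisFun_le {x : Omega} {R : ℝ} (hR : 1 ≤ R) (h10 : ‖basisFun 1 0 x‖ ≤ R)
    (h01 : ‖basisFun 0 1 x‖ ≤ R) (h11 : ‖basisFun 1 1 x‖ ≤ R) (p q : ℕ) :
    ‖basisFun p q x‖ ≤ R ^ (p + q) := by
  have key : ∀ {a : ℂ} {m n k : ℕ}, ‖a‖ ≤ R → m + n ≤ k →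
      ‖a ^ m * basisFun 1 1 x ^ n‖ ≤ R ^ k := fun {a m n k} ha hk => by
    rw [norm_mul, norm_pow, norm_pow]
    calc ‖a‖ ^ m * ‖basisFun 1 1 x‖ ^ n ≤ R ^ m * R ^ n := by gcongr
      _ = R ^ (m + n) := (pow_add R m n).symm
      _ ≤ R ^ k := pow_le_pow_right₀ hR hk
  rcases le_total q p with h | h
  · rw [basisFun_of_le h]
    exact key h10 (by omega)
  · rw [basisFun_of_ge h]
    exact key h01 (by omega)

theorem basisFun_psiPlusInv (p q : ℕ) (z w : ℂ) :
    basisFun p q (psiPlusInv z w) = z ^ p * w ^ q * (1 + z * w) ^ (max p q - p) := by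
  by_cases hs : 1 + z * w = 0
  · have hw : w ≠ 0 := by rintro rfl; simp at hs
    have hz : z = -w⁻¹ := by
      field_simp
      linear_combination hs
    -- The first coordinate is ∞ here, so `basisFun` is evaluated by its reciprocal branch.
    have h10 : basisFun 1 0 (psiPlusInv z w) = z := by
      refine Eq.trans (b := -w⁻¹) ?_ hz.symm
      simp [basisFun, psiPlusInv, sphereDiv, hs, recip, div_neg]
    have h01 : basisFun 0 1 (psiPlusInv z w) = w * (1 + z * w) := by
      simp [basisFun, psiPlusInv, sphereDiv, hs, recip, div_neg]
    have h11 : basisFun 1 1 (psiPlusInv z w) = z * w := by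
      simp [basisFun, psiPlusInv, sphereDiv, recip, hz, hw]
    rcases le_total q p with h | h
    · obtain ⟨k, rfl⟩ := Nat.exists_eq_add_of_le h
      rw [basisFun_of_le h, h10, h11, max_eq_left h]
      simp [pow_add, mul_pow]
      ring
    · obtain ⟨k, rfl⟩ := Nat.exists_eq_add_of_le h
      rw [basisFun_of_ge h, h01, h11, max_eq_right h]
      simp [pow_add, mul_pow]
      ring
  · have h1 : 1 - z / (1 + z * w) * w = (1 + z * w)⁻¹ := by field_simp; ring
    simp only [basisFun, psiPlusInv, sphereDiv, hs, if_false]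
    rw [h1, pow_sub₀ _ hs (le_max_left p q), div_pow, inv_pow]
    field_simp

theorem basisFun_psiMinusInv (p q : ℕ) (z w : ℂ) :
    basisFun p q (psiMinusInv z w) = z ^ p * w ^ q * (1 + z * w) ^ (max p q - q) := by
  by_cases hs : 1 + z * w = 0
  · have hz : z ≠ 0 := by rintro rfl; simp at hs
    have hw : w = -z⁻¹ := by
      field_simp
      linear_combination hs
    have h10 : basisFun 1 0 (psiMinusInv z w) = z * (1 + z * w) := by
      simp [basisFun, psiMinusInv, sphereDiv, hs, recip, div_neg]
    have h01 : basisFun 0 1 (psiMinusInv z w) = w := by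
      refine Eq.trans (b := -z⁻¹) ?_ hw.symm
      simp [basisFun, psiMinusInv, sphereDiv, hs, recip, div_neg]
    have h11 : basisFun 1 1 (psiMinusInv z w) = z * w := by
      simp [basisFun, psiMinusInv, sphereDiv, recip, hz, hw]
    rcases le_total q p with h | h
    · obtain ⟨k, rfl⟩ := Nat.exists_eq_add_of_le h
      rw [basisFun_of_le h, h10, h11, max_eq_left h]
      simp [pow_add, mul_pow]
      ring
    · obtain ⟨k, rfl⟩ := Nat.exists_eq_add_of_le h
      rw [basisFun_of_ge h, h01, h11, max_eq_right h]
      simp [pow_add, mul_pow]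
      ring
  · have h1 : 1 - z * (w / (1 + z * w)) = (1 + z * w)⁻¹ := by field_simp; ring
    simp only [basisFun, psiMinusInv, sphereDiv, hs, if_false]
    rw [h1, pow_sub₀ _ hs (le_max_right p q), div_pow, inv_pow]
    field_simp

/-! ### Rapid decay of the coefficients and convergence. -/

/-- A double sequence decaying faster than `R ^ -(p + q)` for every `R`. -/
def RapidlyDecaying (a : ℕ × ℕ → ℂ) : Prop :=
  ∀ R : ℝ, 1 < R → ∃ M : ℝ, ∀ p q, ‖a (p, q)‖ * R ^ (p + q) ≤ M

theorem RapidlyDecaying.exists_summable_bound {a : ℕ × ℕ → ℂ} (ha : RapidlyDecaying a)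
    {K : Set Omega} {R : ℝ} (h10 : ∀ x ∈ K, ‖basisFun 1 0 x‖ ≤ R)
    (h01 : ∀ x ∈ K, ‖basisFun 0 1 x‖ ≤ R) (h11 : ∀ x ∈ K, ‖basisFun 1 1 x‖ ≤ R) :
    ∃ u : ℕ × ℕ → ℝ, Summable u ∧
      ∀ n : ℕ × ℕ, ∀ x ∈ K, ‖a n * basisFun n.1 n.2 x‖ ≤ u n := by
  set r := max 1 R
  have hr : 1 ≤ r := le_max_left _ _
  -- Since |f_{p,q}| ≤ r^(p+q), decay at rate 2r leaves the summable factor 2^(-(p+q)).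
  obtain ⟨M, hM⟩ := ha (2 * r) (by linarith)
  refine ⟨_, summable_const_mul_pow_mul_pow M (r := 1 / 2) (s := 1 / 2) (by norm_num)
    (by norm_num) (by norm_num) (by norm_num), fun n x hx => ?_⟩
  have h1 := norm_basisFun_le hr ((h10 x hx).trans (le_max_right _ _))
    ((h01 x hx).trans (le_max_right _ _)) ((h11 x hx).trans (le_max_right _ _)) n.1 n.2
  have h2 := hM n.1 n.2
  rw [norm_mul, ← pow_add]
  calc ‖a n‖ * ‖basisFun n.1 n.2 x‖ ≤ ‖a n‖ * r ^ (n.1 + n.2) := by gcongr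
    _ = ‖a n‖ * (2 * r) ^ (n.1 + n.2) * (1 / 2) ^ (n.1 + n.2) := by
      rw [mul_assoc, ← mul_pow]; congr 2; ring
    _ ≤ M * (1 / 2) ^ (n.1 + n.2) := by gcongr

theorem continuous_basisFun (p q : ℕ) : Continuous (basisFun p q) :=
  continuous_of_isHolomorphic (isHolomorphic_basisFun p q)

theorem RapidlyDecaying.exists_summable_bound_of_isCompact {a : ℕ × ℕ → ℂ}
    (ha : RapidlyDecaying a) {K : Set Omega} (hK : IsCompact K) :
    ∃ u : ℕ × ℕ → ℝ, Summable u ∧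
      ∀ n : ℕ × ℕ, ∀ x ∈ K, ‖a n * basisFun n.1 n.2 x‖ ≤ u n := by
  have hb := fun p q => hK.exists_bound_of_continuousOn (continuous_basisFun p q).continuousOn
  obtain ⟨A, hA⟩ := hb 1 0
  obtain ⟨B, hB⟩ := hb 0 1
  obtain ⟨C, hC⟩ := hb 1 1
  refine ha.exists_summable_bound (R := max A (max B C)) (fun x hx => ?_) (fun x hx => ?_)
    fun x hx => ?_
  · exact (hA x hx).trans (by simp)
  · exact (hB x hx).trans (by simp)
  · exact (hC x hx).trans (by simp)

theorem RapidlyDecaying.hasSumLocallyUniformly {a : ℕ × ℕ → ℂ} (ha : RapidlyDecaying a)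
    {f : Omega → ℂ} (hf : ∀ x, HasSum (fun n : ℕ × ℕ => a n * basisFun n.1 n.2 x) (f x)) :
    HasSumLocallyUniformly (fun (n : ℕ × ℕ) (x : Omega) => a n * basisFun n.1 n.2 x) f := by
  refine hasSumLocallyUniformly_of_of_forall_exists_nhds fun x => ?_
  have hb : ∀ p q, ∀ᶠ y in 𝓝 x, ‖basisFun p q y‖ < ‖basisFun p q x‖ + 1 := fun p q =>
    (continuous_basisFun p q).norm.continuousAt.eventually_lt_const (lt_add_one _)
  refine ⟨_, (hb 1 0).and ((hb 0 1).and (hb 1 1)), ?_⟩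
  obtain ⟨u, hu, hle⟩ := ha.exists_summable_bound
    (K := {y | ‖basisFun 1 0 y‖ < ‖basisFun 1 0 x‖ + 1 ∧
      ‖basisFun 0 1 y‖ < ‖basisFun 0 1 x‖ + 1 ∧ ‖basisFun 1 1 y‖ < ‖basisFun 1 1 x‖ + 1})
    (R := ‖basisFun 1 0 x‖ + ‖basisFun 0 1 x‖ + ‖basisFun 1 1 x‖ + 1)
    (fun y hy => by linarith [hy.1, norm_nonneg (basisFun 0 1 x), norm_nonneg (basisFun 1 1 x)])
    (fun y hy => by linarith [hy.2.1, norm_nonneg (basisFun 1 0 x), norm_nonneg (basisFun 1 1 x)])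
    (fun y hy => by linarith [hy.2.2, norm_nonneg (basisFun 0 1 x), norm_nonneg (basisFun 1 0 x)])
  rw [hasSumUniformlyOn_iff_tendstoUniformlyOn]
  exact (tendstoUniformlyOn_tsum hu hle).congr_right fun y _ => (hf y).tsum_eq

/-- At `psiPlusInv R R` the terms with q ≤ p have norm exactly |a_{p,q}| R^(p+q), and at
`psiMinusInv R R` those with p ≤ q do. Each is at most the sum of the norms, which is finite since
convergence in ℂ is unconditional. -/
theorem rapidlyDecaying_of_hasSum {a : ℕ × ℕ → ℂ} {f : Omega → ℂ}
    (hf : ∀ x, HasSum (fun n : ℕ × ℕ => a n * basisFun n.1 n.2 x) (f x)) :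
    RapidlyDecaying a := by
  intro R hR
  have hp := (hf (psiPlusInv R R)).summable.norm
  have hm := (hf (psiMinusInv R R)).summable.norm
  refine ⟨max (∑' n : ℕ × ℕ, ‖a n * basisFun n.1 n.2 (psiPlusInv R R)‖)
    (∑' n : ℕ × ℕ, ‖a n * basisFun n.1 n.2 (psiMinusInv R R)‖), fun p q => ?_⟩
  have hR0 : 0 ≤ R := by linarith
  rcases le_total q p with h | h
  · refine le_trans ?_ (le_max_left _ _)
    refine le_trans (le_of_eq ?_) (hp.le_tsum (p, q) fun _ _ => norm_nonneg _)
    simp [basisFun_psiPlusInv, h, pow_add, abs_of_nonneg hR0]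
  · refine le_trans ?_ (le_max_right _ _)
    refine le_trans (le_of_eq ?_) (hm.le_tsum (p, q) fun _ _ => norm_nonneg _)
    simp [basisFun_psiMinusInv, h, pow_add, abs_of_nonneg hR0]

/-! ### Coefficient functionals and biorthogonality. -/

/-- Composition with a continuous map as a continuous linear map. -/
noncomputable def precompCLM {X Y : Type*} [TopologicalSpace X] [TopologicalSpace Y]
    (φ : C(X, Y)) : C(Y, ℂ) →L[ℂ] C(X, ℂ) where
  toFun f := f.comp φ
  map_add' _ _ := rfl
  map_smul' _ _ := rfl
  cont := ContinuousMap.continuous_precomp φ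

/-- The continuous map `(z, w) ↦ (z / (1 + z * w), w)`. -/
noncomputable def psiPlusMap : C(ℂ × ℂ, Omega) := ⟨_, continuous_psiPlusInv⟩

/-- The continuous map `(z, w) ↦ (z, w / (1 + z * w))`. -/
noncomputable def psiMinusMap : C(ℂ × ℂ, Omega) := ⟨_, continuous_psiMinusInv⟩

/-- The coefficient functional of `basisFun p q`. -/
noncomputable def coeffCLM (p q : ℕ) : C(Omega, ℂ) →L[ℂ] ℂ :=
  torusCoeff p q ∘L precompCLM (if p < q then psiMinusMap else psiPlusMap)

theorem coeffCLM_of_lt {p q : ℕ} (h : p < q) (f : C(Omega, ℂ)) :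
    coeffCLM p q f = torusCoeff p q (f.comp psiMinusMap) := by
  rw [coeffCLM, if_pos h]; rfl

theorem coeffCLM_of_le {p q : ℕ} (h : q ≤ p) (f : C(Omega, ℂ)) :
    coeffCLM p q f = torusCoeff p q (f.comp psiPlusMap) := by
  rw [coeffCLM, if_neg h.not_gt]; rfl

theorem coeffCLM_eq_schauderCoeff (p q : ℕ) (f : C(Omega, ℂ)) :
    coeffCLM p q f = schauderCoeff f p q := by
  have key : ∀ g : C(ℂ × ℂ, ℂ), torusCoeff p q g = -1 / (4 * (Real.pi : ℂ) ^ 2) *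
      ∮ w in C(0, 1), ∮ z in C(0, 1), g (z, w) / (z ^ (p + 1) * w ^ (q + 1)) := by
    intro g
    rw [torusCoeff_apply, cauchyCoeff_apply]
    have h1 : ∀ w : ℂ, ((cauchyCoeff p).compLeftContinuous ℂ ℂ (currySnd g)) w / w ^ (q + 1) =
        (2 * Real.pi * Complex.I : ℂ)⁻¹ *
          ∮ z in C(0, 1), g (z, w) / (z ^ (p + 1) * w ^ (q + 1)) := by
      intro w
      change (2 * Real.pi * Complex.I : ℂ)⁻¹ * (∮ z in C(0, 1), g (z, w) / z ^ (p + 1)) / _ = _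
      rw [mul_div_assoc, div_eq_inv_mul _ (w ^ (q + 1)), ← circleIntegral.integral_const_mul]
      congr 2
      ext z
      rw [div_mul_eq_div_div, div_eq_inv_mul _ (w ^ (q + 1))]
    simp only [h1]
    rw [circleIntegral.integral_const_mul, smul_eq_mul, ← mul_assoc]
    congr 1
    have := Complex.I_sq
    have hpi : (Real.pi : ℂ) ≠ 0 := Complex.ofReal_ne_zero.2 Real.pi_ne_zero
    field_simp
    rw [this]; norm_num
  unfold schauderCoeff coeffIntegrand
  rcases lt_or_ge p q with h | h
  · rw [coeffCLM_of_lt h, key]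
    simp only [if_pos h]
    rfl
  · rw [coeffCLM_of_le h, key]
    simp only [if_neg h.not_gt]
    rfl

/-- Expanding the power of 1 + zw yields only monomials whose exponents differ by i - j. -/
theorem torusCoeff_monomial_mul_one_add_pow {p q i j k : ℕ} (hij : (i : ℤ) - j ≠ p - q)
    {g : C(ℂ × ℂ, ℂ)} (hg : ∀ z w, g (z, w) = z ^ i * w ^ j * (1 + z * w) ^ k) :
    torusCoeff p q g = 0 := by
  let m : ℕ → C(ℂ × ℂ, ℂ) := fun l =>
    ⟨fun x => (k.choose l : ℂ) * (x.1 ^ (i + l) * x.2 ^ (j + l)), by fun_prop⟩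
  have : g = ∑ l ∈ Finset.range (k + 1), m l := by
    ext ⟨z, w⟩
    rw [hg, add_comm 1, add_pow, Finset.mul_sum, ContinuousMap.sum_apply]
    refine Finset.sum_congr rfl fun l _ => ?_
    simp only [m, ContinuousMap.coe_mk]
    ring
  rw [this, map_sum]
  refine Finset.sum_eq_zero fun l _ => ?_
  rw [torusCoeff_monomial p q (i + l) (j + l) (k.choose l) fun z w => rfl, if_neg (by omega)]

/-- `basisFun p q` as a continuous function. -/
noncomputable def basisMap (n : ℕ × ℕ) : C(Omega, ℂ) :=
  ⟨basisFun n.1 n.2, continuous_basisFun n.1 n.2⟩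

theorem coeffCLM_basisMap (p q : ℕ) (n : ℕ × ℕ) :
    coeffCLM p q (basisMap n) = if n = (p, q) then 1 else 0 := by
  obtain ⟨i, j⟩ := n
  simp only [Prod.mk.injEq]
  rcases lt_or_ge p q with h | h
  · rw [coeffCLM_of_lt h]
    rcases le_or_gt i j with h' | h'
    · refine torusCoeff_monomial p q i j 1 fun z w => (basisFun_psiMinusInv i j z w).trans ?_
      simp [h']
    · rw [if_neg (by omega)]
      exact torusCoeff_monomial_mul_one_add_pow (by omega) (basisFun_psiMinusInv i j)
  · rw [coeffCLM_of_le h]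
    rcases le_or_gt j i with h' | h'
    · refine torusCoeff_monomial p q i j 1 fun z w => (basisFun_psiPlusInv i j z w).trans ?_
      simp [h']
    · rw [if_neg (by omega)]
      exact torusCoeff_monomial_mul_one_add_pow (by omega) (basisFun_psiPlusInv i j)

theorem RapidlyDecaying.hasSum_basisMap {a : ℕ × ℕ → ℂ} (ha : RapidlyDecaying a)
    {f : C(Omega, ℂ)} (hf : ∀ x, HasSum (fun n : ℕ × ℕ => a n * basisFun n.1 n.2 x) (f x)) :
    HasSum (fun n => a n • basisMap n) f :=
  ContinuousMap.hasSum_of_forall_isCompact hf fun _ hK => ha.exists_summable_bound_of_isCompact hK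

theorem eq_coeffCLM_of_hasSum {a : ℕ × ℕ → ℂ} {f : C(Omega, ℂ)}
    (hf : ∀ x, HasSum (fun n : ℕ × ℕ => a n * basisFun n.1 n.2 x) (f x)) (p q : ℕ) :
    a (p, q) = coeffCLM p q f := by
  have h := (coeffCLM p q).hasSum ((rapidlyDecaying_of_hasSum hf).hasSum_basisMap hf)
  refine HasSum.unique ?_ h
  convert! hasSum_ite_eq (p, q) (a (p, q)) using 2 with n
  rw [map_smul, coeffCLM_basisMap]
  split_ifs with h
  · rw [h, smul_eq_mul, mul_one]
  · simp

/-! ### Comparison of the two Taylor expansions and existence of the expansion. -/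

/-- The principal part of a Laurent series vanishing on the punctured plane has sum zero. -/
theorem hasSum_principal_part_eq_zero {d : ℕ × ℕ → ℂ}
    (hd : ∀ t : ℂ, t ≠ 0 → HasSum (fun n : ℕ × ℕ => d n * t ^ ((n.1 : ℤ) - n.2)) 0) :
    HasSum (fun n : ℕ × ℕ => if n.1 < n.2 then d n else 0) 0 := by
  have hs : ∀ R : ℝ, 0 < R → Summable fun n : ℕ × ℕ => ‖d n‖ * R ^ ((n.1 : ℤ) - n.2) := by
    intro R hR
    have := (hd R (Complex.ofReal_ne_zero.2 hR.ne')).summable.norm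
    simpa [norm_zpow, abs_of_pos hR] using this
  -- φ is the regular part, an entire function. Off 0 it is minus the principal part, whose
  -- exponents are at most -1, so it is O(1/|t|) at infinity and vanishes by Liouville.
  let φ : ℂ → ℂ := fun t => ∑' n : ℕ × ℕ, if n.1 < n.2 then 0 else d n * t ^ (n.1 - n.2)
  have hφle : ∀ R : ℝ, ∀ n : ℕ × ℕ, ∀ t : ℂ, t ∈ Metric.ball (0 : ℂ) R →
      ‖(if n.1 < n.2 then 0 else d n * t ^ (n.1 - n.2))‖ ≤ ‖d n‖ * R ^ ((n.1 : ℤ) - n.2) := by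
    intro R n t ht
    have ht' : ‖t‖ < R := by simpa using ht
    have hR : 0 < R := (norm_nonneg t).trans_lt ht'
    split_ifs with h
    · rw [norm_zero]; positivity
    · rw [norm_mul, norm_pow, ← Nat.cast_sub (not_lt.1 h), zpow_natCast]
      gcongr
  have hφd : Differentiable ℂ φ := by
    intro t
    have hR : 0 < ‖t‖ + 1 := by positivity
    have := Complex.differentiableOn_tsum_of_summable_norm (hs _ hR) (fun n => ?_)
      Metric.isOpen_ball (hφle (‖t‖ + 1))
    · exact this.differentiableAt (Metric.isOpen_ball.mem_nhds (by simp))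
    · split_ifs <;> fun_prop
  have hφs : ∀ t : ℂ, HasSum (fun n : ℕ × ℕ => if n.1 < n.2 then 0 else d n * t ^ (n.1 - n.2))
      (φ t) := fun t =>
    (Summable.of_norm_bounded (hs (‖t‖ + 1) (by positivity))
      fun n => hφle (‖t‖ + 1) n t (by simp)).hasSum
  have hψ : ∀ t : ℂ, t ≠ 0 → HasSum (fun n : ℕ × ℕ =>
      if n.1 < n.2 then d n * t ^ ((n.1 : ℤ) - n.2) else 0) (-φ t) := by
    intro t ht
    have := (hd t ht).sub (hφs t)
    rw [zero_sub] at this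
    convert! this using 2 with n
    split_ifs with h
    · rw [sub_zero]
    · rw [← Nat.cast_sub (not_lt.1 h), zpow_natCast, sub_self]
  have hs1 : Summable fun n => ‖d n‖ := by simpa using hs 1 one_pos
  have hφle' : ∀ t : ℂ, 1 ≤ ‖t‖ → ‖φ t‖ ≤ (∑' n, ‖d n‖) * ‖t‖⁻¹ := by
    intro t ht
    have ht0 : t ≠ 0 := by rintro rfl; norm_num at ht
    rw [← norm_neg, ← (hψ t ht0).tsum_eq]
    refine tsum_of_norm_bounded (hs1.hasSum.mul_right _) fun n => ?_
    split_ifs with h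
    · rw [norm_mul, norm_zpow, ← zpow_neg_one]
      exact mul_le_mul_of_nonneg_left (zpow_le_zpow_right₀ ht (by omega)) (norm_nonneg _)
    · rw [norm_zero]; positivity
  have hφ0 : φ 1 = 0 := by
    refine hφd.apply_eq_of_tendsto_cocompact 1 ?_
    rw [tendsto_zero_iff_norm_tendsto_zero, ← Metric.cobounded_eq_cocompact]
    have hlim : Tendsto (fun t : ℂ => (∑' n, ‖d n‖) * ‖t‖⁻¹) (Bornology.cobounded ℂ) (𝓝 0) := by
      simpa using (tendsto_inv_atTop_zero.comp tendsto_norm_cobounded_atTop).const_mul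
        (∑' n, ‖d n‖)
    refine squeeze_zero' (Eventually.of_forall fun t => norm_nonneg _) ?_ hlim
    filter_upwards [tendsto_norm_cobounded_atTop.eventually_ge_atTop 1] with t ht
    exact hφle' t ht
  simpa [hφ0] using hψ 1 one_ne_zero

theorem rapidlyDecaying_coeffCLM {f : C(Omega, ℂ)} (hf : IsHolomorphic f) :
    RapidlyDecaying fun n => coeffCLM n.1 n.2 f := by
  intro R hR
  obtain ⟨M, hM⟩ := exists_norm_torusCoeff_mul_pow_le (g := f.comp psiPlusMap)
    (differentiable_comp_psiPlusInv hf) hR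
  obtain ⟨N, hN⟩ := exists_norm_torusCoeff_mul_pow_le (g := f.comp psiMinusMap)
    (differentiable_comp_psiMinusInv hf) hR
  refine ⟨max M N, fun p q => ?_⟩
  rcases lt_or_ge p q with h | h
  · simp only [coeffCLM_of_lt h]
    exact (hN p q).trans (le_max_right _ _)
  · simp only [coeffCLM_of_le h]
    exact (hM p q).trans (le_max_left _ _)

/-- With s = 1 + zw, this transition multiplies z^p w^q by s^(p-q), exactly the factor in
`basisFun_psiMinusInv` for p ≥ q. -/
theorem psiPlusInv_eq_psiMinusInv {z w : ℂ} (hs : 1 + z * w ≠ 0) :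
    psiPlusInv ((1 + z * w) * z) (w / (1 + z * w)) = psiMinusInv z w := by
  have h : 1 + (1 + z * w) * z * (w / (1 + z * w)) = 1 + z * w := by field_simp
  apply Subtype.ext
  simp only [psiPlusInv, psiMinusInv, sphereDiv, h, hs, if_false]
  rw [mul_div_cancel_left₀ _ hs]

theorem hasSum_coeffCLM_psiMinusInv {f : C(Omega, ℂ)} (hf : IsHolomorphic f) {z w : ℂ}
    (hs : 1 + z * w ≠ 0) :
    HasSum (fun n : ℕ × ℕ => coeffCLM n.1 n.2 f * basisFun n.1 n.2 (psiMinusInv z w))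
      (f (psiMinusInv z w)) := by
  set s := 1 + z * w with hs_def
  have hpow : ∀ (t : ℂ), t ≠ 0 → ∀ n : ℕ × ℕ, (t * z) ^ n.1 * (w / t) ^ n.2 =
      z ^ n.1 * w ^ n.2 * t ^ ((n.1 : ℤ) - n.2) := fun t ht n => by
    rw [mul_pow, div_pow, zpow_sub₀ ht, zpow_natCast, zpow_natCast]
    field_simp
  have hplus : ∀ t : ℂ, t ≠ 0 → HasSum (fun n : ℕ × ℕ =>
      torusCoeff n.1 n.2 (f.comp psiPlusMap) *
        (z ^ n.1 * w ^ n.2 * (s * t) ^ ((n.1 : ℤ) - n.2))) (f (psiMinusInv (t * z) (w / t))) := by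
    intro t ht
    have h := hasSum_torusCoeff_of_differentiable (g := f.comp psiPlusMap)
      (differentiable_comp_psiPlusInv hf) (s * t * z) (w / (s * t))
    simp only [hpow _ (mul_ne_zero hs ht)] at h
    have hst : 1 + t * z * (w / t) = s := by rw [hs_def]; field_simp
    have e : f (psiMinusInv (t * z) (w / t)) =
        f.comp psiPlusMap (s * t * z, w / (s * t)) := by
      rw [← psiPlusInv_eq_psiMinusInv (by rwa [hst]), hst]
      change f (psiPlusInv _ _) = f (psiPlusInv _ _)
      congr 2
      · ring
      · rw [div_div, mul_comm]
    rw [e]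
    exact h
  have hminus : ∀ t : ℂ, t ≠ 0 → HasSum (fun n : ℕ × ℕ =>
      torusCoeff n.1 n.2 (f.comp psiMinusMap) *
        (z ^ n.1 * w ^ n.2 * t ^ ((n.1 : ℤ) - n.2))) (f (psiMinusInv (t * z) (w / t))) := by
    intro t ht
    have h := hasSum_torusCoeff_of_differentiable (g := f.comp psiMinusMap)
      (differentiable_comp_psiMinusInv hf) (t * z) (w / t)
    simp only [hpow _ ht] at h
    exact h
  have hprin := hasSum_principal_part_eq_zero (d := fun n : ℕ × ℕ =>
    torusCoeff n.1 n.2 (f.comp psiMinusMap) * (z ^ n.1 * w ^ n.2) -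
      torusCoeff n.1 n.2 (f.comp psiPlusMap) *
        (z ^ n.1 * w ^ n.2 * s ^ ((n.1 : ℤ) - n.2))) fun t ht => by
    have := (hminus t ht).sub (hplus t ht)
    rw [sub_self] at this
    convert! this using 2 with n
    rw [mul_zpow]
    ring
  -- At t = 1, adding the vanishing principal part of the difference turns the terms p < q of the
  -- plus series into those of the minus series.
  have := (hplus 1 one_ne_zero).add hprin
  simp only [one_mul, div_one, mul_one, add_zero] at this
  convert! this using 2 with n
  rw [basisFun_psiMinusInv, ← hs_def]
  split_ifs with h
  · rw [coeffCLM_of_lt h, max_eq_right h.le, Nat.sub_self, pow_zero]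
    ring
  · have h := not_lt.1 h
    rw [coeffCLM_of_le h, max_eq_left h, ← Nat.cast_sub h, zpow_natCast, add_zero]

theorem hasSum_coeffCLM {f : C(Omega, ℂ)} (hf : IsHolomorphic f) (x : Omega) :
    HasSum (fun n : ℕ × ℕ => coeffCLM n.1 n.2 f * basisFun n.1 n.2 x) (f x) := by
  have hdecay := rapidlyDecaying_coeffCLM hf
  let F : Omega → ℂ := fun x => ∑' n : ℕ × ℕ, coeffCLM n.1 n.2 f * basisFun n.1 n.2 x
  have hF : ∀ x, HasSum (fun n : ℕ × ℕ => coeffCLM n.1 n.2 f * basisFun n.1 n.2 x) (F x) := by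
    intro x
    obtain ⟨u, hu, hle⟩ := hdecay.exists_summable_bound_of_isCompact (isCompact_singleton (x := x))
    exact (Summable.of_norm_bounded hu fun n => hle n x rfl).hasSum
  have hFc : Continuous F := by
    refine TendstoLocallyUniformly.continuous
      (hasSumLocallyUniformly_iff_tendstoLocallyUniformly.1 (hdecay.hasSumLocallyUniformly hF))
      (Frequently.of_forall fun s => ?_)
    exact continuous_finsetSum _ fun n _ => continuous_const.mul (continuous_basisFun _ _)
  have hFf : F = f := by
    refine hFc.ext_on dense_finite_points f.continuous ?_
    rintro x ⟨z, v, hx⟩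
    have hzv : 1 - z * v ≠ 0 :=
      sub_ne_zero.2 (Ne.symm (mem_chartRange_of_mem_Omega (hx ▸ x.2)))
    -- Every finite point (z, v) of `Omega` is the image of (z, v/(1 - zv)) under `psiMinusInv`,
    -- with 1 + zw ≠ 0 there.
    have h1 : 1 + z * (v / (1 - z * v)) = (1 - z * v)⁻¹ := by field_simp; ring
    have hs : 1 + z * (v / (1 - z * v)) ≠ 0 := by rw [h1]; exact inv_ne_zero hzv
    have hxe : x = psiMinusInv z (v / (1 - z * v)) := by
      apply Subtype.ext
      rw [hx]
      simp only [psiMinusInv, sphereDiv, hs, if_false]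
      rw [h1, div_inv_eq_mul, div_mul_cancel₀ _ hzv]
    rw [hxe]
    exact (hF _).unique (hasSum_coeffCLM_psiMinusInv hf hs)
  rw [← hFf]
  exact hF x

/-! ### The Schauder basis and the final statement. -/

/-- `basisFun p q` as an element of the space of holomorphic functions. -/
noncomputable def basisHol (n : ℕ × ℕ) : HolOmega :=
  ⟨basisMap n, isHolomorphic_basisFun n.1 n.2⟩

theorem hasSum_basisHol (f : HolOmega) :
    HasSum (fun n : ℕ × ℕ => coeffCLM n.1 n.2 (f : C(Omega, ℂ)) • basisHol n) f := by
  have h : HasSum (fun n : ℕ × ℕ => coeffCLM n.1 n.2 (f : C(Omega, ℂ)) • basisMap n)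
      (f : C(Omega, ℂ)) :=
    (rapidlyDecaying_coeffCLM f.2).hasSum_basisMap (hasSum_coeffCLM f.2)
  refine Topology.IsInducing.subtypeVal.hasSum_iff (g := HolOmega.subtype) _ _ |>.1 ?_
  exact h

theorem isSchauderBasis_basisHol (σ : ℕ ≃ ℕ × ℕ) : IsSchauderBasis fun n => basisHol (σ n) := by
  let coord : ℕ → HolOmega →L[ℂ] ℂ := fun n =>
    coeffCLM (σ n).1 (σ n).2 ∘L HolOmega.subtypeL
  have hcoord : ∀ m n, coord m (basisHol (σ n)) = if n = m then 1 else 0 := fun m n => by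
    refine (coeffCLM_basisMap _ _ (σ n)).trans ?_
    simp
  have hlim : ∀ x : HolOmega,
      Tendsto (fun N => ∑ n ∈ Finset.range N, coord n x • basisHol (σ n)) atTop (𝓝 x) :=
    fun x => (σ.hasSum_iff.2 (hasSum_basisHol x)).tendsto_sum_nat
  refine ⟨fun x => ⟨fun n => coord n x, hlim x, fun a ha => funext fun m => ?_⟩, coord, hlim⟩
  -- Uniqueness needs only ordered partial sums: by biorthogonality `coord m` takes the value `a m`
  -- on all of them with N > m.
  refine tendsto_nhds_unique ?_ (((coord m).continuous.tendsto x).comp ha)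
  refine tendsto_const_nhds.congr' ?_
  filter_upwards [eventually_gt_atTop m] with N hN
  simp [map_sum, hcoord, hN]

end ComplexifiedCircle

theorem corollary4p6 :
    ∃ e : ℕ × ℕ → HolOmega,
      -- the functions `f_{p,q}` are holomorphic on `Omega`
      (∀ (p q : ℕ) (x : Omega), (e (p, q) : C(Omega, ℂ)) x = basisFun p q x) ∧
      -- they form a Schauder basis, in whatever order they are enumerated
      (∀ σ : ℕ ≃ ℕ × ℕ, IsSchauderBasis (fun n => e (σ n))) ∧
      ∀ f : Omega → ℂ, IsHolomorphic f →
        -- every holomorphic function has a unique expansion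
        (∃! a : ℕ × ℕ → ℂ,
          ∀ x : Omega, HasSum (fun n : ℕ × ℕ => a n * basisFun n.1 n.2 x) (f x)) ∧
        -- the Cauchy integrals below have continuous integrands
        (∀ p q : ℕ, ContinuousOn (fun x : ℂ × ℂ => coeffIntegrand f p q x.1 x.2)
          (Metric.sphere (0 : ℂ) 1 ×ˢ Metric.sphere (0 : ℂ) 1)) ∧
        ∀ a : ℕ × ℕ → ℂ,
          (∀ x : Omega, HasSum (fun n : ℕ × ℕ => a n * basisFun n.1 n.2 x) (f x)) →
          -- absolute convergence, uniformly on compact sets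
          (∀ K : Set Omega, IsCompact K → ∃ u : ℕ × ℕ → ℝ, Summable u ∧
            ∀ n : ℕ × ℕ, ∀ x ∈ K, ‖a n * basisFun n.1 n.2 x‖ ≤ u n) ∧
          -- locally uniform convergence
          HasSumLocallyUniformly (fun (n : ℕ × ℕ) (x : Omega) => a n * basisFun n.1 n.2 x) f ∧
          -- formula for the coefficients
          ∀ p q : ℕ, a (p, q) = schauderCoeff f p q := by
  refine ⟨basisHol, fun p q x => rfl, isSchauderBasis_basisHol, fun f hf => ?_⟩
  let F : C(Omega, ℂ) := ⟨f, continuous_of_isHolomorphic hf⟩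
  refine ⟨⟨fun n => coeffCLM n.1 n.2 F, hasSum_coeffCLM (f := F) hf, fun a ha => funext fun n =>
    eq_coeffCLM_of_hasSum (f := F) ha n.1 n.2⟩, fun p q => ?_, fun a ha => ?_⟩
  · have hf' := continuous_of_isHolomorphic hf
    have hnum : Continuous fun x : ℂ × ℂ =>
        if p < q then f (psiMinusInv x.1 x.2) else f (psiPlusInv x.1 x.2) := by
      split_ifs
      · exact hf'.comp continuous_psiMinusInv
      · exact hf'.comp continuous_psiPlusInv
    refine hnum.continuousOn.div (by fun_prop) ?_
    rintro ⟨z, w⟩ ⟨hz, hw⟩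
    have hz0 : z ≠ 0 := by rintro rfl; simp at hz
    have hw0 : w ≠ 0 := by rintro rfl; simp at hw
    exact mul_ne_zero (pow_ne_zero _ hz0) (pow_ne_zero _ hw0)
  · have hdecay := rapidlyDecaying_of_hasSum ha
    exact ⟨fun K hK => hdecay.exists_summable_bound_of_isCompact hK,
      hdecay.hasSumLocallyUniformly ha, fun p q =>
      (eq_coeffCLM_of_hasSum (f := F) ha p q).trans (coeffCLM_eq_schauderCoeff p q F)⟩
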